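/- Let $\varphi:\mathbb R\to\mathbb R$ be an Orlicz N-function (continuous, even, convex, increasing on $(0,\infty)$, $\varphi(0)=0$, $\varphi(x)/x\to0$ as $x\to0$, $\varphi(x)/x\to\infty$ as $x\to\infty$) satisfying Condition Q: $\lim_{x\to0}\varphi(x)/x^2$ exists in $(0,+\infty]$. Let $\varphi^*(x)=\sup_{y\in\mathbb R}(xy-\varphi(y))$. A centered random variable $\xi$ is called $\varphi$-sub-Gaussian if for some $a\ge0$ one has $\mathbf E e^{\lambda\xi}\le e^{\varphi(a\lambda)}$ for all $\lambda\in\mathbb R$; then $\tau_\varphi(\xi):=\sup_{\lambda\ne0}\varphi^{(-1)}(\ln\mathbf E e^{\lambda\xi})/|\lambda|$, where $\varphi^{(-1)}$ is the inverse of $\varphi$ on $[0,\infty)$. Let $T\ge 0$ and let $X(t)$, $t\in[0,T]$, be a process on a probability space, each $X(t)$ being $\varphi$-sub-Gaussian. Assume that $X$ is separable in the sense of Doob with respect to the pseudometric $\rho_X(t,s)=\tau_\varphi(X(t)-X(s))$ (by the assumptions on $\sigma$ below, this is implied by separability with respect to the usual metric of $[0,T]$), that $\varepsilon_0:=\sup_{t\in[0,T]}\tau_\varphi(X(t))\in(0,\infty)$,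 and that $$\sup_{|t-s|\le h}\tau_\varphi(X(t)-X(s))\le\sigma(h),\qquad h\ge0,$$ where $\sigma:[0,\infty)\to[0,\infty)$ is a nondecreasing continuous function with $\sigma(0)=0$. Let $r:[1,\infty)\to[0,\infty)$ be a nondecreasing function such that $x\mapsto r(e^x)$, $x\ge0$, is convex. Put $\sigma^{(-1)}(u):=\sup\{h\ge0:\sigma(h)\le u\}\in[0,\infty]$ and $r^{(-1)}(y):=\sup\{x\ge1:r(x)\le y\}\in[1,\infty]$ for $y\ge r(1)$ (for strictly increasing functions these are the ordinary inverses on the ranges of $\sigma$ and $r$), with $T/(2\cdot\infty):=0$. If $$\tilde I_r(v):=\int_0^v r\left(\frac{T}{2\sigma^{(-1)}(u)}+1\right)du<\infty\qquad\text{for all } v>0,$$ then for all $\theta\in(0,1)$ and $\varepsilon>0$ $$\mathbf P\left\{\sup_{t\in[0,T]}|X(t)|\ge\varepsilon\right\}\le 2\exp\left\{-\varphi^*\left(\frac{\varepsilon(1-\theta)}{\varepsilon_0}\right)\right\}r^{(-1)}\left(\frac{\tilde I_r(\theta\varepsilon_0)}{\theta\varepsilon_0}\right).$$ -/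

import Mathlib

open MeasureTheory ProbabilityTheory Set Filter Topology
open scoped ENNReal

noncomputable section

/-- Orlicz N-functions. -/
structure IsOrliczNFunction (φ : ℝ → ℝ) : Prop where
  continuous : Continuous φ
  even : ∀ x, φ (-x) = φ x
  convex : ConvexOn ℝ univ φ
  strictMono : StrictMonoOn φ (Ioi 0)
  map_zero : φ 0 = 0
  tendsto_zero : Tendsto (fun x => φ x / x) (𝓝[≠] 0) (𝓝 0)
  tendsto_atTop : Tendsto (fun x => φ x / x) atTop atTop

/-- Condition Q: `φ x / x ^ 2` has a limit `C ∈ (0, +∞]` as `x → 0`. -/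
def ConditionQ (φ : ℝ → ℝ) : Prop :=
  ∃ C : EReal, 0 < C ∧ Tendsto (fun x : ℝ => ((φ x / x ^ 2 : ℝ) : EReal)) (𝓝[≠] 0) (𝓝 C)

/-- The Young-Fenchel transform; the supremum is finite for every Orlicz N-function. -/
def youngFenchel (φ : ℝ → ℝ) (x : ℝ) : ℝ :=
  ⨆ y : ℝ, (x * y - φ y)

/-- The random variable `ξ` belongs to `Sub_φ(Ω)`. -/
def IsPhiSubGaussian {Ω : Type*} [MeasurableSpace Ω] (P : Measure Ω) (φ : ℝ → ℝ)
    (ξ : Ω → ℝ) : Prop :=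
  Measurable ξ ∧ Integrable ξ P ∧ ∫ ω, ξ ω ∂P = 0 ∧
    ∃ a : ℝ, 0 ≤ a ∧ ∀ l : ℝ, Integrable (fun ω => Real.exp (l * ξ ω)) P ∧
      ∫ ω, Real.exp (l * ξ ω) ∂P ≤ Real.exp (φ (a * l))

/-- The norm `τ_φ(ξ) = sup_{l ≠ 0} φ⁻¹(ln E exp(l ξ)) / |l|` of `Sub_φ(Ω)`, where `φ⁻¹` is the
inverse of the bijection `φ : [0, ∞) → [0, ∞)`. For `ξ` in `Sub_φ(Ω)` the expectations are finite
and at least `1`, and the supremum is finite. -/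
def tauNorm {Ω : Type*} [MeasurableSpace Ω] (P : Measure Ω) (φ : ℝ → ℝ) (ξ : Ω → ℝ) : ℝ :=
  ⨆ l : {l : ℝ // l ≠ 0},
    Function.invFunOn φ (Ici 0) (Real.log (∫ ω, Real.exp ((l : ℝ) * ξ ω) ∂P)) / |(l : ℝ)|

/-- The pseudometric `ρ_X(t, s) = τ_φ(X(t) - X(s))` generated by a process `X`. -/
def processDist {Ω ι : Type*} [MeasurableSpace Ω] (P : Measure Ω) (φ : ℝ → ℝ)
    (X : ι → Ω → ℝ) (t s : ι) : ℝ :=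
  tauNorm P φ (fun ω => X t ω - X s ω)

/-- Openness with respect to a pseudometric `ρ`. -/
def IsOpenFor {ι : Type*} (ρ : ι → ι → ℝ) (U : Set ι) : Prop :=
  ∀ t ∈ U, ∃ δ > 0, ∀ s, ρ t s < δ → s ∈ U

/-- Separability, in Doob's sense, of a process indexed by a pseudometric space `(ι, ρ)`: there is
a countable dense set `S` such that, off one null set, for all open `U` and closed `F`, the path
maps `U` into `F` as soon as it maps `U ∩ S` into `F`. -/
def IsSeparableProcess {Ω ι : Type*} [MeasurableSpace Ω] (P : Measure Ω) (ρ : ι → ι → ℝ)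
    (X : ι → Ω → ℝ) : Prop :=
  ∃ S : Set ι, S.Countable ∧ (∀ t, ∀ δ > 0, ∃ s ∈ S, ρ t s < δ) ∧
    ∀ᵐ ω ∂P, ∀ (U : Set ι) (F : Set ℝ), IsOpenFor ρ U → IsClosed F →
      (∀ t ∈ U ∩ S, X t ω ∈ F) → ∀ t ∈ U, X t ω ∈ F

/-- The inverse `f⁻¹(y) = sup {x ≥ a : f x ≤ y}` in `[0, ∞]` of a nondecreasing function `f` on
`[a, ∞)`, where `a ≥ 0`. It is the ordinary inverse if `f` is continuous and strictly increasing
and `y` is a value of `f`, and it is `∞` if `f ≤ y` throughout. -/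
def incInv (a : ℝ) (f : ℝ → ℝ) (y : ℝ) : ℝ≥0∞ :=
  ⨆ x ∈ {x : ℝ | a ≤ x ∧ f x ≤ y}, ENNReal.ofReal x

/-- `T / (2 σ⁻¹(u)) + 1`, where `T / (2 * ∞) = 0`. -/
def coverBound (T : ℝ) (σ : ℝ → ℝ) (u : ℝ) : ℝ :=
  (ENNReal.ofReal T / (2 * incInv 0 σ u)).toReal + 1

/-- `Ĩ_r(v) = ∫_0^v r(T / (2 σ⁻¹(u)) + 1) du`. -/
def entropyIntegral (T : ℝ) (σ r : ℝ → ℝ) (v : ℝ) : ℝ :=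
  ∫ u in (0 : ℝ)..v, r (coverBound T σ u)

end

namespace IsOrliczNFunction

variable {φ : ℝ → ℝ}

theorem nonneg (hφ : IsOrliczNFunction φ) (x : ℝ) : 0 ≤ φ x := by
  have h := hφ.convex.2 (mem_univ x) (mem_univ (-x)) (by norm_num : (0 : ℝ) ≤ 1 / 2)
    (by norm_num : (0 : ℝ) ≤ 1 / 2) (by norm_num)
  simp only [smul_eq_mul, hφ.even] at h
  rw [show 1 / 2 * x + 1 / 2 * -x = 0 by ring, hφ.map_zero] at h
  linarith

theorem map_abs (hφ : IsOrliczNFunction φ) (x : ℝ) : φ |x| = φ x := by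
  rcases abs_choice x with h | h <;> rw [h]
  exact hφ.even x

theorem strictMonoOn_Ici (hφ : IsOrliczNFunction φ) : StrictMonoOn φ (Ici 0) := by
  intro x hx y hy hxy
  rcases (mem_Ici.1 hx).eq_or_lt with rfl | hx0
  · rw [hφ.map_zero]
    have : φ (y / 2) < φ y := hφ.strictMono (half_pos hxy) hxy (half_lt_self hxy)
    exact (hφ.nonneg _).trans_lt this
  · exact hφ.strictMono hx0 (hx0.trans hxy) hxy

theorem le_of_abs_le (hφ : IsOrliczNFunction φ) {x y : ℝ} (h : |x| ≤ |y|) : φ x ≤ φ y := by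
  rw [← hφ.map_abs x, ← hφ.map_abs y]
  exact hφ.strictMonoOn_Ici.monotoneOn (abs_nonneg x) (abs_nonneg y) h

theorem surjOn (hφ : IsOrliczNFunction φ) : SurjOn φ (Ici 0) (Ici 0) := by
  intro y hy
  obtain ⟨x, hx1, hxy⟩ := ((eventually_ge_atTop (1 : ℝ)).and
    (hφ.tendsto_atTop.eventually_ge_atTop y)).exists
  have hx : y ≤ φ x := by
    rw [le_div_iff₀ (by linarith)] at hxy
    have : 0 ≤ y := hy
    nlinarith
  have := intermediate_value_Icc (by linarith : (0 : ℝ) ≤ x) hφ.continuous.continuousOn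
  rw [hφ.map_zero] at this
  obtain ⟨z, hz, rfl⟩ := this ⟨hy, hx⟩
  exact ⟨z, hz.1, rfl⟩

theorem invFunOn_nonneg (hφ : IsOrliczNFunction φ) {y : ℝ} (hy : 0 ≤ y) :
    0 ≤ Function.invFunOn φ (Ici 0) y :=
  Function.invFunOn_mem (hφ.surjOn hy)

theorem map_invFunOn (hφ : IsOrliczNFunction φ) {y : ℝ} (hy : 0 ≤ y) :
    φ (Function.invFunOn φ (Ici 0) y) = y :=
  Function.invFunOn_eq (hφ.surjOn hy)

theorem invFunOn_le_iff (hφ : IsOrliczNFunction φ) {x y : ℝ} (hx : 0 ≤ x) (hy : 0 ≤ y) :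
    Function.invFunOn φ (Ici 0) y ≤ x ↔ y ≤ φ x := by
  rw [← hφ.strictMonoOn_Ici.le_iff_le (hφ.invFunOn_nonneg hy) hx, hφ.map_invFunOn hy]

end IsOrliczNFunction

namespace IsPhiSubGaussian

variable {Ω : Type*} [MeasurableSpace Ω] {P : Measure Ω}
  {φ : ℝ → ℝ} {ξ η : Ω → ℝ}

theorem one_le_integral_exp [IsProbabilityMeasure P] (hξ : IsPhiSubGaussian P φ ξ) (l : ℝ) :
    1 ≤ ∫ ω, Real.exp (l * ξ ω) ∂P := by
  obtain ⟨-, hint, h0, a, -, ha⟩ := hξ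
  have h1 : ∫ ω, (l * ξ ω + 1) ∂P = 1 := by
    rw [integral_add (hint.const_mul l) (integrable_const 1), integral_const_mul, h0]
    simp
  rw [← h1]
  exact integral_mono ((hint.const_mul l).add (integrable_const 1)) (ha l).1
    fun ω => Real.add_one_le_exp _

theorem sub (hφ : IsOrliczNFunction φ) (hξ : IsPhiSubGaussian P φ ξ)
    (hη : IsPhiSubGaussian P φ η) : IsPhiSubGaussian P φ (fun ω => ξ ω - η ω) := by
  obtain ⟨mξ, iξ, zξ, a, ha, hξ⟩ := hξ
  obtain ⟨mη, iη, zη, b, hb, hη⟩ := hη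
  refine ⟨mξ.sub mη, iξ.sub iη, by rw [integral_sub iξ iη, zξ, zη, sub_zero],
    2 * max a b, by positivity, fun l => ?_⟩
  have hdom : ∀ ω, Real.exp (l * (ξ ω - η ω)) ≤
      2⁻¹ * (Real.exp ((2 * l) * ξ ω) + Real.exp ((-2 * l) * η ω)) := fun ω => by
    have e1 : Real.exp ((2 * l) * ξ ω) = Real.exp (l * ξ ω) ^ 2 := by
      rw [← Real.exp_nat_mul]; congr 1; push_cast; ring
    have e2 : Real.exp ((-2 * l) * η ω) = Real.exp (-(l * η ω)) ^ 2 := by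
      rw [← Real.exp_nat_mul]; congr 1; push_cast; ring
    rw [mul_sub, sub_eq_add_neg, Real.exp_add, e1, e2]
    nlinarith [sq_nonneg (Real.exp (l * ξ ω) - Real.exp (-(l * η ω)))]
  have hi : Integrable (fun ω => 2⁻¹ * (Real.exp ((2 * l) * ξ ω) + Real.exp ((-2 * l) * η ω))) P :=
    ((hξ _).1.add (hη _).1).const_mul _
  have hi' : Integrable (fun ω => Real.exp (l * (ξ ω - η ω))) P := by
    refine hi.mono' (by fun_prop) (ae_of_all _ fun ω => ?_)
    rw [Real.norm_of_nonneg (Real.exp_nonneg _)]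
    exact hdom ω
  refine ⟨hi', (integral_mono hi' hi hdom).trans ?_⟩
  rw [integral_const_mul, integral_add (hξ _).1 (hη _).1]
  have h1 : ∫ ω, Real.exp ((2 * l) * ξ ω) ∂P ≤ Real.exp (φ (2 * max a b * l)) := by
    refine (hξ _).2.trans (Real.exp_le_exp.2 (hφ.le_of_abs_le ?_))
    simp only [abs_mul, abs_of_nonneg ha, abs_of_nonneg (ha.trans (le_max_left a b)), abs_two]
    nlinarith [abs_nonneg l, le_max_left a b, mul_le_mul_of_nonneg_right (le_max_left a b)
      (abs_nonneg l)]
  have h2 : ∫ ω, Real.exp ((-2 * l) * η ω) ∂P ≤ Real.exp (φ (2 * max a b * l)) := by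
    refine (hη _).2.trans (Real.exp_le_exp.2 (hφ.le_of_abs_le ?_))
    simp only [abs_mul, abs_neg, abs_of_nonneg hb, abs_of_nonneg (ha.trans (le_max_left a b)),
      abs_two]
    nlinarith [mul_le_mul_of_nonneg_right (le_max_right a b) (abs_nonneg l)]
  linarith

theorem integral_exp_le [IsProbabilityMeasure P] (hφ : IsOrliczNFunction φ) (hξ : IsPhiSubGaussian P φ ξ) {c : ℝ}
    (hc : tauNorm P φ ξ ≤ c) (l : ℝ) : ∫ ω, Real.exp (l * ξ ω) ∂P ≤ Real.exp (φ (c * l)) := by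
  rcases eq_or_ne l 0 with rfl | hl
  · simp [hφ.map_zero]
  have hlog : ∀ l, 0 ≤ Real.log (∫ ω, Real.exp (l * ξ ω) ∂P) := fun l =>
    Real.log_nonneg (hξ.one_le_integral_exp l)
  have hpos : ∀ l, 0 < ∫ ω, Real.exp (l * ξ ω) ∂P := fun l =>
    one_pos.trans_le (hξ.one_le_integral_exp l)
  have hbdd : BddAbove (range fun l : {l : ℝ // l ≠ 0} => Function.invFunOn φ (Ici 0)
      (Real.log (∫ ω, Real.exp ((l : ℝ) * ξ ω) ∂P)) / |(l : ℝ)|) := by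
    obtain ⟨-, -, -, a, ha, hle⟩ := hξ
    refine ⟨a, ?_⟩
    rintro _ ⟨⟨k, hk⟩, rfl⟩
    simp only
    rw [div_le_iff₀ (abs_pos.2 hk), hφ.invFunOn_le_iff (by positivity) (hlog k),
      Real.log_le_iff_le_exp (hpos k)]
    refine (hle k).2.trans (Real.exp_le_exp.2 (hφ.le_of_abs_le ?_))
    simp [abs_mul]
  have h := (le_ciSup hbdd ⟨l, hl⟩).trans hc
  simp only at h
  rw [div_le_iff₀ (abs_pos.2 hl)] at h
  have hcl : 0 ≤ c * |l| := (hφ.invFunOn_nonneg (hlog l)).trans h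
  rw [hφ.invFunOn_le_iff hcl (hlog l), Real.log_le_iff_le_exp (hpos l)] at h
  refine h.trans (Real.exp_le_exp.2 (hφ.le_of_abs_le ?_))
  simp [abs_mul]

theorem lintegral_exp_abs_le [IsProbabilityMeasure P] (hφ : IsOrliczNFunction φ) (hξ : IsPhiSubGaussian P φ ξ) {c : ℝ}
    (hc : tauNorm P φ ξ ≤ c) (l : ℝ) :
    ∫⁻ ω, ENNReal.ofReal (Real.exp (l * |ξ ω|)) ∂P ≤
      2 * ENNReal.ofReal (Real.exp (φ (c * l))) := by
  have key : ∀ l, ∫⁻ ω, ENNReal.ofReal (Real.exp (l * ξ ω)) ∂P ≤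
      ENNReal.ofReal (Real.exp (φ (c * l))) := fun l => by
    have hi : Integrable (fun ω => Real.exp (l * ξ ω)) P := by
      obtain ⟨-, -, -, a, -, h⟩ := hξ
      exact (h l).1
    rw [← ofReal_integral_eq_lintegral_ofReal hi (ae_of_all _ fun _ => Real.exp_nonneg _)]
    exact ENNReal.ofReal_le_ofReal (hξ.integral_exp_le hφ hc l)
  have hm := hξ.1
  calc ∫⁻ ω, ENNReal.ofReal (Real.exp (l * |ξ ω|)) ∂P
      ≤ ∫⁻ ω, (ENNReal.ofReal (Real.exp (l * ξ ω)) +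
          ENNReal.ofReal (Real.exp (-l * ξ ω))) ∂P := by
        refine lintegral_mono fun ω => ?_
        rcases abs_choice (ξ ω) with h | h <;> simp only [h]
        · exact le_self_add
        · rw [mul_neg, neg_mul]
          exact le_add_self
    _ = _ := lintegral_add_left (by fun_prop) _
    _ ≤ ENNReal.ofReal (Real.exp (φ (c * l))) + ENNReal.ofReal (Real.exp (φ (c * -l))) :=
        add_le_add (key l) (key (-l))
    _ = _ := by rw [mul_neg, hφ.even, two_mul]

end IsPhiSubGaussian

theorem incInv_mono (a : ℝ) (f : ℝ → ℝ) : Monotone (incInv a f) := fun _ _ h =>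
  biSup_mono fun _ hx => ⟨hx.1, hx.2.trans h⟩

theorem le_incInv {a : ℝ} {f : ℝ → ℝ} {x y : ℝ} (hx : a ≤ x) (h : f x ≤ y) :
    ENNReal.ofReal x ≤ incInv a f y :=
  le_iSup₂_of_le x ⟨hx, h⟩ le_rfl

theorem incInv_pos {σ : ℝ → ℝ} (hσ : ContinuousOn σ (Ici 0)) (hσ0 : σ 0 = 0) {u : ℝ}
    (hu : 0 < u) : 0 < incInv 0 σ u := by
  have h0 : ∀ᶠ x in 𝓝[>] (0 : ℝ), σ x < u :=
    (((hσ 0 self_mem_Ici).mono Ioi_subset_Ici_self).tendsto).eventually_lt_const (by rwa [hσ0])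
  obtain ⟨x, hx, hx0⟩ := (h0.and self_mem_nhdsWithin).exists
  exact (ENNReal.ofReal_pos.2 hx0).trans_le (le_incInv (le_of_lt hx0) hx.le)

theorem one_le_coverBound (T : ℝ) (σ : ℝ → ℝ) (u : ℝ) : 1 ≤ coverBound T σ u :=
  le_add_of_nonneg_left ENNReal.toReal_nonneg

theorem coverBound_anti {σ : ℝ → ℝ} (T : ℝ) (hσ : ContinuousOn σ (Ici 0)) (hσ0 : σ 0 = 0)
    {u v : ℝ} (hu : 0 < u) (huv : u ≤ v) : coverBound T σ v ≤ coverBound T σ u := by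
  refine add_le_add_left (ENNReal.toReal_mono ?_ ?_) 1
  · exact (ENNReal.div_lt_top ENNReal.ofReal_ne_top
      (mul_ne_zero two_ne_zero (incInv_pos hσ hσ0 hu).ne')).ne
  · gcongr
    exact incInv_mono 0 σ huv

/-- A segment of length `T` is covered by at most `T / (2 h) + 1` segments of length `2 h`. -/
theorem exists_finset_cover_Icc {T h : ℝ} (hT : 0 ≤ T) (hh : 0 < h) :
    ∃ V : Finset (Icc (0 : ℝ) T), (V.card : ℝ) ≤ T / (2 * h) + 1 ∧
      ∀ t : Icc (0 : ℝ) T, ∃ v ∈ V, |(t : ℝ) - v| ≤ h := by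
  classical
  have h2 : 0 < 2 * h := by positivity
  have hTh : 0 ≤ T / (2 * h) := by positivity
  refine ⟨(Finset.range (max 1 ⌈T / (2 * h)⌉₊)).image
    fun j : ℕ => projIcc 0 T hT ((2 * j + 1) * h), ?_, fun t => ?_⟩
  · refine (Nat.cast_le.2 Finset.card_image_le).trans ?_
    rw [Finset.card_range, Nat.cast_max]
    exact max_le (by simpa using hTh) (Nat.ceil_lt_add_one hTh).le
  · have htj : ⌈(t : ℝ) / (2 * h)⌉₊ ≤ ⌈T / (2 * h)⌉₊ :=
      Nat.ceil_mono (div_le_div_of_nonneg_right t.2.2 h2.le)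
    refine ⟨_, Finset.mem_image_of_mem _ (a := ⌈(t : ℝ) / (2 * h)⌉₊ - 1) ?_, ?_⟩
    · rw [Finset.mem_range]
      omega
    · have hproj : ∀ x : ℝ, |(t : ℝ) - projIcc 0 T hT x| ≤ |(t : ℝ) - x| := fun x => by
        have h1 := t.2.1
        have h2 := t.2.2
        rw [coe_projIcc]
        rcases le_total x 0 with hx | hx
        · rw [min_eq_right (hx.trans hT), max_eq_left hx, abs_of_nonneg, abs_of_nonneg] <;>
            linarith
        rcases le_total x T with hx' | hx'
        · rw [min_eq_right hx', max_eq_right hx]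
        · rw [min_eq_left hx', max_eq_right hT, abs_of_nonpos, abs_of_nonpos] <;> linarith
      refine (hproj _).trans ?_
      set k := ⌈(t : ℝ) / (2 * h)⌉₊ with hk
      have hle : (t : ℝ) / (2 * h) ≤ k := Nat.le_ceil _
      have hlt : (k : ℝ) < (t : ℝ) / (2 * h) + 1 := Nat.ceil_lt_add_one (div_nonneg t.2.1 h2.le)
      have ht : (t : ℝ) / (2 * h) * (2 * h) = t := div_mul_cancel₀ _ h2.ne'
      have ht0 := t.2.1
      rcases Nat.eq_zero_or_pos k with h0 | h0
      · rw [h0] at hle ⊢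
        have : (t : ℝ) ≤ 0 := by
          rw [← ht]
          exact mul_nonpos_of_nonpos_of_nonneg (by simpa using hle) h2.le
        rw [abs_le]
        constructor <;> norm_num <;> linarith
      · rw [Nat.cast_sub h0, abs_le]
        push_cast
        constructor <;> nlinarith

/-- Covering of `[0, T]` by balls of radius `u` of a pseudometric with modulus `σ`. -/
theorem exists_finset_net {T : ℝ} (hT : 0 ≤ T) {σ : ℝ → ℝ} (hσ : ContinuousOn σ (Ici 0))
    (hσ0 : σ 0 = 0) {ρ : Icc (0 : ℝ) T → Icc (0 : ℝ) T → ℝ}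
    (hρ : ∀ h : ℝ, 0 ≤ h → ∀ t s : Icc (0 : ℝ) T, |(t : ℝ) - s| ≤ h → ρ t s ≤ σ h)
    {u : ℝ} (hu : 0 < u) :
    ∃ V : Finset (Icc (0 : ℝ) T), (V.card : ℝ) ≤ coverBound T σ u ∧
      ∀ t, ∃ v ∈ V, ρ t v ≤ u := by
  set A : Set ℝ := {x | 0 ≤ x ∧ σ x ≤ u} with hA
  have hA0 : (0 : ℝ) ∈ A := ⟨le_rfl, by rw [hσ0]; exact hu.le⟩
  by_cases hb : BddAbove A
  · have hclosed : IsClosed A := hσ.preimage_isClosed_of_isClosed isClosed_Ici isClosed_Iic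
    have hmem : sSup A ∈ A := hclosed.csSup_mem ⟨0, hA0⟩ hb
    set h := sSup A with hh
    have hinv : incInv 0 σ u = ENNReal.ofReal h :=
      le_antisymm (iSup₂_le fun x hx => ENNReal.ofReal_le_ofReal (le_csSup hb hx))
        (le_incInv hmem.1 hmem.2)
    have hpos : 0 < h := by
      have := incInv_pos hσ hσ0 hu
      rwa [hinv, ENNReal.ofReal_pos] at this
    obtain ⟨V, hV, hcov⟩ := exists_finset_cover_Icc hT hpos
    refine ⟨V, hV.trans_eq ?_, fun t => ?_⟩
    · rw [coverBound, hinv, ENNReal.toReal_div, ENNReal.toReal_mul, ENNReal.toReal_ofReal hT,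
        ENNReal.toReal_ofReal hpos.le, ENNReal.toReal_ofNat]
    · obtain ⟨v, hv, hd⟩ := hcov t
      exact ⟨v, hv, (hρ h hmem.1 t v hd).trans hmem.2⟩
  · obtain ⟨h, hhA, hh⟩ := not_bddAbove_iff.1 hb T
    refine ⟨{⟨0, left_mem_Icc.2 hT⟩}, by simpa using one_le_coverBound T σ u, fun t =>
      ⟨_, Finset.mem_singleton_self _, (hρ h hhA.1 _ _ ?_).trans hhA.2⟩⟩
    rw [sub_zero, abs_of_nonneg t.2.1]
    exact t.2.2.trans hh.le

/-- Riemann sum of the entropy integral along the geometric partition. -/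
theorem geom_sum_le_entropyIntegral {T : ℝ} {σ r : ℝ → ℝ} (hσ : ContinuousOn σ (Ici 0))
    (hσ0 : σ 0 = 0) (hrmono : MonotoneOn r (Ici 1))
    (hI : ∀ v : ℝ, 0 < v → IntervalIntegrable (fun u => r (coverBound T σ u)) volume 0 v)
    {θ : ℝ} (hθ : θ ∈ Ioo (0 : ℝ) 1) (n : ℕ) {δ : ℝ} (hδ : 0 < δ) :
    ∑ i ∈ Finset.range n, (1 - θ) * θ ^ i * r (coverBound T σ (δ * θ ^ i)) + θ ^ n * r 1 ≤
      entropyIntegral T σ r δ / δ := by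
  obtain ⟨hθ0, hθ1⟩ := hθ
  have hge : ∀ {a b c : ℝ}, 0 ≤ a → a ≤ b → (∀ u ∈ Ioo a b, c ≤ r (coverBound T σ u)) →
      (b - a) * c ≤ ∫ u in a..b, r (coverBound T σ u) := by
    intro a b c ha hab h
    have hint : IntervalIntegrable (fun u => r (coverBound T σ u)) volume a b := by
      have h1 : 0 < b + 1 := by linarith
      refine (hI (b + 1) h1).mono_set ?_
      rw [uIcc_of_le hab, uIcc_of_le h1.le]
      exact Icc_subset_Icc ha (by linarith)
    have := intervalIntegral.integral_mono_on_of_le_Ioo hab intervalIntegrable_const hint h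
    simpa using this
  rw [le_div_iff₀ hδ]
  suffices h : ∀ n : ℕ, (∑ i ∈ Finset.range n, (1 - θ) * θ ^ i * r (coverBound T σ (δ * θ ^ i))) * δ
      + ∫ u in (0 : ℝ)..(δ * θ ^ n), r (coverBound T σ u) ≤ entropyIntegral T σ r δ by
    have h1 := hge (c := r 1) le_rfl (by positivity : 0 ≤ δ * θ ^ n) fun u _ =>
      hrmono self_mem_Ici (one_le_coverBound T σ u) (one_le_coverBound T σ u)
    have h2 := h n
    linarith
  intro n
  induction n with
  | zero => simp [entropyIntegral]
  | succ n ih =>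
    have hpos : 0 < δ * θ ^ (n + 1) := by positivity
    have hle : δ * θ ^ (n + 1) ≤ δ * θ ^ n := by
      rw [pow_succ]
      have : 0 < δ * θ ^ n := by positivity
      nlinarith
    have hsplit : (∫ u in (0 : ℝ)..(δ * θ ^ (n + 1)), r (coverBound T σ u)) +
        ∫ u in (δ * θ ^ (n + 1))..(δ * θ ^ n), r (coverBound T σ u) =
        ∫ u in (0 : ℝ)..(δ * θ ^ n), r (coverBound T σ u) := by
      refine intervalIntegral.integral_add_adjacent_intervals (hI _ hpos)
        ((hI _ (hpos.trans_le hle)).mono_set ?_)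
      rw [uIcc_of_le hle, uIcc_of_le (hpos.le.trans hle)]
      exact Icc_subset_Icc_left hpos.le
    have h1 := hge (c := r (coverBound T σ (δ * θ ^ n))) hpos.le hle fun u hu =>
      hrmono (one_le_coverBound T σ _) (one_le_coverBound T σ u)
        (coverBound_anti T hσ hσ0 (hpos.trans hu.1) hu.2.le)
    have h2 : (δ * θ ^ n - δ * θ ^ (n + 1)) = (1 - θ) * θ ^ n * δ := by ring
    rw [h2] at h1
    rw [Finset.sum_range_succ]
    linarith

/-- A geometric mean of numbers is bounded through the arithmetic mean of their images. -/
theorem prod_rpow_le_incInv {r : ℝ → ℝ} (hrconv : ConvexOn ℝ (Ici 0) (fun x => r (Real.exp x)))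
    {n : ℕ} {w N : ℕ → ℝ} {q y : ℝ} (hw : ∀ i, 0 ≤ w i) (hq : 0 ≤ q)
    (hsum : ∑ i ∈ Finset.range n, w i + q = 1) (hN : ∀ i, 1 ≤ N i)
    (hy : ∑ i ∈ Finset.range n, w i * r (N i) + q * r 1 ≤ y) :
    ENNReal.ofReal (∏ i ∈ Finset.range n, N i ^ w i) ≤ incInv 1 r y := by
  have hpos : ∀ i, 0 < N i := fun i => one_pos.trans_le (hN i)
  refine le_incInv (Finset.one_le_prod fun i _ => Real.one_le_rpow (hN i) (hw i)) ?_
  have h := hrconv.map_sum_le (t := Finset.range (n + 1))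
    (w := fun i => if i < n then w i else q)
    (p := fun i => if i < n then Real.log (N i) else 0)
    (fun i _ => by split_ifs; exacts [hw i, hq])
    (by
      rw [Finset.sum_range_succ, ← hsum]
      simp only [lt_irrefl, if_false]
      congr 1
      exact Finset.sum_congr rfl fun i hi => by rw [if_pos (Finset.mem_range.1 hi)])
    (fun i _ => by split_ifs; exacts [Real.log_nonneg (hN i), self_mem_Ici])
  simp only [Finset.sum_range_succ, lt_irrefl, if_false, smul_eq_mul, mul_zero, add_zero,
    Real.exp_zero] at h
  have e1 : ∑ i ∈ Finset.range n, (if i < n then w i else q) * (if i < n then Real.log (N i) else 0)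
      = ∑ i ∈ Finset.range n, w i * Real.log (N i) :=
    Finset.sum_congr rfl fun i hi => by simp [Finset.mem_range.1 hi]
  have e2 : ∑ i ∈ Finset.range n, (if i < n then w i else q) *
      r (Real.exp (if i < n then Real.log (N i) else 0)) = ∑ i ∈ Finset.range n, w i * r (N i) :=
    Finset.sum_congr rfl fun i hi => by simp [Finset.mem_range.1 hi, Real.exp_log (hpos i)]
  rw [e1, e2] at h
  have e3 : ∏ i ∈ Finset.range n, N i ^ w i = Real.exp (∑ i ∈ Finset.range n, w i * Real.log (N i)) := by
    rw [Real.exp_sum]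
    exact Finset.prod_congr rfl fun i _ => by rw [Real.rpow_def_of_pos (hpos i), mul_comm]
  rw [e3]
  exact h.trans hy

/-- Increments along a chain: `X v` at level `0`, and `X v - X (π i v)` at level `i + 1`. -/
def chainIncrement {Ω ι : Type*} (X : ι → Ω → ℝ) (π : ℕ → ι → ι) : ℕ → ι → Ω → ℝ
  | 0, v => X v
  | i + 1, v => fun ω => X v ω - X (π i v) ω

theorem ofReal_exp_abs_le_prod {Ω ι : Type*} (X : ι → Ω → ℝ) {π : ℕ → ι → ι}
    {V : ℕ → Finset ι} {n : ℕ} (hπ : ∀ i < n, ∀ v ∈ V (i + 1), π i v ∈ V i)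
    {w : ℕ → ℝ} (hw : ∀ i, 0 < w i) {l : ℝ} (hl : 0 ≤ l) (ω : Ω) {v : ι} (hv : v ∈ V n) :
    ENNReal.ofReal (Real.exp (l * |X v ω|)) ≤ ∏ i ∈ Finset.range (n + 1),
      (∑ u ∈ V i, ENNReal.ofReal (Real.exp (l / w i * |chainIncrement X π i u ω|))) ^ w i := by
  have step : ∀ i, ∀ v ∈ V i, ENNReal.ofReal (Real.exp (l * |chainIncrement X π i v ω|)) ≤
      (∑ u ∈ V i, ENNReal.ofReal (Real.exp (l / w i * |chainIncrement X π i u ω|))) ^ w i := by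
    intro i v hv
    have h1 : ENNReal.ofReal (Real.exp (l * |chainIncrement X π i v ω|)) =
        ENNReal.ofReal (Real.exp (l / w i * |chainIncrement X π i v ω|)) ^ w i := by
      rw [ENNReal.ofReal_rpow_of_pos (Real.exp_pos _), ← Real.exp_mul]
      congr 2
      have := (hw i).ne'
      field_simp
    rw [h1]
    exact ENNReal.rpow_le_rpow (Finset.single_le_sum
      (f := fun u => ENNReal.ofReal (Real.exp (l / w i * |chainIncrement X π i u ω|)))
      (fun _ _ => zero_le) hv) (hw i).le
  have main : ∀ m ≤ n, ∀ v ∈ V m, ENNReal.ofReal (Real.exp (l * |X v ω|)) ≤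
      ∏ i ∈ Finset.range (m + 1),
        (∑ u ∈ V i, ENNReal.ofReal (Real.exp (l / w i * |chainIncrement X π i u ω|))) ^ w i := by
    intro m
    induction m with
    | zero =>
      intro _ v hv
      rw [Finset.prod_range_one]
      exact step 0 v hv
    | succ m ih =>
      intro hm v hv
      rw [Finset.prod_range_succ]
      refine le_trans ?_ (mul_le_mul' (ih (by omega) _ (hπ m hm v hv)) (step (m + 1) v hv))
      rw [← ENNReal.ofReal_mul (Real.exp_nonneg _), ← Real.exp_add, ← mul_add]
      refine ENNReal.ofReal_le_ofReal (Real.exp_le_exp.2 (mul_le_mul_of_nonneg_left ?_ hl))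
      have h := abs_add_le (X (π m v) ω) (X v ω - X (π m v) ω)
      rwa [add_sub_cancel] at h
  exact main n le_rfl v hv

/-- Chaining bound for the maximum of a process over the last level of a finite chain. -/
theorem measure_exists_ge_le_of_chain {Ω ι : Type*} [MeasurableSpace Ω] {P : Measure Ω}
    [IsProbabilityMeasure P] {φ : ℝ → ℝ} (hφ : IsOrliczNFunction φ) {X : ι → Ω → ℝ}
    (hX : ∀ t, IsPhiSubGaussian P φ (X t)) {π : ℕ → ι → ι} {V : ℕ → Finset ι} {n : ℕ}
    (hπ : ∀ i < n, ∀ v ∈ V (i + 1), π i v ∈ V i) {w : ℕ → ℝ} (hw : ∀ i, 0 < w i)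
    (hsum : ∑ i ∈ Finset.range (n + 1), w i = 1) {c : ℝ}
    (hτ : ∀ i ≤ n, ∀ v ∈ V i, tauNorm P φ (chainIncrement X π i v) ≤ c * w i)
    {l : ℝ} (hl : 0 ≤ l) (e : ℝ) :
    P {ω | ∃ v ∈ V n, e ≤ |X v ω|} ≤ 2 * ENNReal.ofReal (Real.exp (-(l * e - φ (c * l)))) *
      ∏ i ∈ Finset.range (n + 1), ((V i).card : ℝ≥0∞) ^ w i := by
  have hsub : ∀ i v, IsPhiSubGaussian P φ (chainIncrement X π i v) := by
    intro i v
    cases i with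
    | zero => exact hX v
    | succ i => exact (hX v).sub hφ (hX _)
  set g : ℕ → Ω → ℝ≥0∞ := fun i ω =>
    ∑ u ∈ V i, ENNReal.ofReal (Real.exp (l / w i * |chainIncrement X π i u ω|)) with hg
  have hgm : ∀ i, Measurable (g i) := fun i => Finset.measurable_fun_sum _ fun u _ => by
    have := (hsub i u).1
    fun_prop
  set K : ℝ≥0∞ := 2 * ENNReal.ofReal (Real.exp (φ (c * l))) with hK
  have hgle : ∀ i ≤ n, ∫⁻ ω, g i ω ∂P ≤ (V i).card * K := by
    intro i hi
    rw [hg, lintegral_finsetSum _ fun u _ => by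
      have := (hsub i u).1
      fun_prop, ← nsmul_eq_mul]
    refine Finset.sum_le_card_nsmul _ _ _ fun u hu => ?_
    refine ((hsub i u).lintegral_exp_abs_le hφ (hτ i hi u hu) _).trans_eq ?_
    rw [hK, mul_assoc, mul_div_cancel₀ _ (hw i).ne']
  have hprod : ∫⁻ ω, ∏ i ∈ Finset.range (n + 1), g i ω ^ w i ∂P ≤
      K * ∏ i ∈ Finset.range (n + 1), ((V i).card : ℝ≥0∞) ^ w i := by
    refine (ENNReal.lintegral_prod_norm_pow_le _ (fun i _ => (hgm i).aemeasurable) hsum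
      fun i _ => (hw i).le).trans ?_
    calc ∏ i ∈ Finset.range (n + 1), (∫⁻ ω, g i ω ∂P) ^ w i
        ≤ ∏ i ∈ Finset.range (n + 1), ((V i).card * K) ^ w i :=
          Finset.prod_le_prod' fun i hi => ENNReal.rpow_le_rpow
            (hgle i (Nat.lt_succ_iff.1 (Finset.mem_range.1 hi))) (hw i).le
      _ = ∏ i ∈ Finset.range (n + 1), (((V i).card : ℝ≥0∞) ^ w i * K ^ w i) :=
          Finset.prod_congr rfl fun i _ => ENNReal.mul_rpow_of_nonneg _ _ (hw i).le
      _ = _ := by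
          have hK0 : K ≠ 0 := mul_ne_zero two_ne_zero
            (ENNReal.ofReal_pos.2 (Real.exp_pos _)).ne'
          have hKt : K ≠ ⊤ := ENNReal.mul_ne_top ENNReal.ofNat_ne_top ENNReal.ofReal_ne_top
          have hpow : ∀ s : Finset ℕ, ∏ i ∈ s, K ^ w i = K ^ ∑ i ∈ s, w i := by
            intro s
            induction s using Finset.cons_induction with
            | empty => simp
            | cons a s ha ih => rw [Finset.prod_cons, Finset.sum_cons, ih,
                ENNReal.rpow_add _ _ hK0 hKt]
          rw [Finset.prod_mul_distrib, mul_comm, hpow, hsum, ENNReal.rpow_one]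
  have hmarkov := mul_meas_ge_le_lintegral (μ := P)
    (Finset.measurable_fun_prod (Finset.range (n + 1)) fun i _ => (hgm i).pow_const (w i))
    (ENNReal.ofReal (Real.exp (l * e)))
  have hincl : {ω | ∃ v ∈ V n, e ≤ |X v ω|} ⊆
      {ω | ENNReal.ofReal (Real.exp (l * e)) ≤ ∏ i ∈ Finset.range (n + 1), g i ω ^ w i} := by
    rintro ω ⟨v, hv, hev⟩
    refine le_trans (ENNReal.ofReal_le_ofReal (Real.exp_le_exp.2 ?_))
      (ofReal_exp_abs_le_prod X hπ hw hl ω hv)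
    exact mul_le_mul_of_nonneg_left hev hl
  have hfin := (mul_le_mul_right (measure_mono hincl (μ := P))
    (ENNReal.ofReal (Real.exp (l * e)))).trans (hmarkov.trans hprod)
  have hmul : ∀ x : ℝ≥0∞, ENNReal.ofReal (Real.exp (-(l * e))) *
      (ENNReal.ofReal (Real.exp (l * e)) * x) = x := fun x => by
    rw [← mul_assoc, ← ENNReal.ofReal_mul (Real.exp_nonneg _), ← Real.exp_add]
    simp
  have h2 := mul_le_mul_right hfin (ENNReal.ofReal (Real.exp (-(l * e))))
  rw [hmul] at h2
  refine h2.trans_eq ?_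
  rw [hK, neg_sub, sub_eq_neg_add, Real.exp_add, ENNReal.ofReal_mul (Real.exp_nonneg _)]
  ring

theorem measure_finset_ge_le {Ω : Type*} [MeasurableSpace Ω] {P : Measure Ω}
    [IsProbabilityMeasure P] {φ : ℝ → ℝ} (hφ : IsOrliczNFunction φ)
    {T : ℝ} (hT : 0 ≤ T) {X : Icc (0 : ℝ) T → Ω → ℝ}
    (hX : ∀ t, IsPhiSubGaussian P φ (X t))
    {ε₀ : ℝ} (hε₀ : ∀ t, tauNorm P φ (X t) ≤ ε₀) (hε₀pos : 0 < ε₀)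
    {σ : ℝ → ℝ} (hσcont : ContinuousOn σ (Ici 0)) (hσ0 : σ 0 = 0)
    (hXσ : ∀ h : ℝ, 0 ≤ h → ∀ t s : Icc (0 : ℝ) T, |(t : ℝ) - s| ≤ h →
      processDist P φ X t s ≤ σ h)
    {r : ℝ → ℝ} (hrmono : MonotoneOn r (Ici 1))
    (hrconv : ConvexOn ℝ (Ici 0) (fun x => r (Real.exp x)))
    (hI : ∀ v : ℝ, 0 < v →
      IntervalIntegrable (fun u => r (coverBound T σ u)) volume 0 v)
    {θ : ℝ} (hθ : θ ∈ Ioo (0 : ℝ) 1) (F : Finset (Icc (0 : ℝ) T)) {l : ℝ} (hl : 0 ≤ l) (e : ℝ) :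
    P {ω | ∃ v ∈ F, e ≤ |X v ω|} ≤
      2 * ENNReal.ofReal (Real.exp (-(l * e - φ (ε₀ / (1 - θ) * l)))) *
        incInv 1 r (entropyIntegral T σ r (θ * ε₀) / (θ * ε₀)) := by
  rcases F.eq_empty_or_nonempty with rfl | hF
  · simp
  obtain ⟨hθ0, hθ1⟩ := hθ
  have h1θ : 0 < 1 - θ := by linarith
  have hδ : 0 < θ * ε₀ := by positivity
  have hrad : ∀ i : ℕ, 0 < θ * ε₀ * θ ^ i := fun i => by positivity
  choose W hWcard hWcov using fun i : ℕ => exists_finset_net hT hσcont hσ0 hXσ (hrad i)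
  choose π hπmem hπle using hWcov
  have hWne : ∀ i, 1 ≤ (W i).card := fun i =>
    Finset.card_pos.2 ⟨_, hπmem i ⟨0, left_mem_Icc.2 hT⟩⟩
  set A : ℝ≥0∞ := 2 * ENNReal.ofReal (Real.exp (-(l * e - φ (ε₀ / (1 - θ) * l)))) with hA
  set R : ℝ≥0∞ := incInv 1 r (entropyIntegral T σ r (θ * ε₀) / (θ * ε₀)) with hR
  have hA0 : A ≠ 0 := mul_ne_zero two_ne_zero (ENNReal.ofReal_pos.2 (Real.exp_pos _)).ne'
  have hgeom : ∀ n : ℕ, ∑ i ∈ Finset.range n, (1 - θ) * θ ^ i + θ ^ n = 1 := fun n => by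
    induction n with
    | zero => simp
    | succ n ih =>
      rw [Finset.sum_range_succ, pow_succ]
      linarith
  have key : ∀ n : ℕ, P {ω | ∃ v ∈ F, e ≤ |X v ω|} ≤
      A * (R * (F.card : ℝ≥0∞) ^ (θ ^ n)) := by
    intro n
    set V : ℕ → Finset (Icc (0 : ℝ) T) := fun i => if i < n then W i else F with hV
    set w : ℕ → ℝ := fun i => if i < n then (1 - θ) * θ ^ i else θ ^ n with hw
    have hVn : V n = F := by simp [hV]
    have hwn : w n = θ ^ n := by simp [hw]
    have hVlt : ∀ {i}, i < n → V i = W i := fun h => by simp [hV, h]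
    have hwlt : ∀ {i}, i < n → w i = (1 - θ) * θ ^ i := fun h => by simp [hw, h]
    have hwpos : ∀ i, 0 < w i := fun i => by
      simp only [hw]
      split_ifs <;> positivity
    have hwsum : ∑ i ∈ Finset.range n, w i + θ ^ n = 1 := by
      rw [← hgeom n]
      congr 1
      exact Finset.sum_congr rfl fun i hi => hwlt (Finset.mem_range.1 hi)
    have hwge : ∀ i ≤ n, (1 - θ) * θ ^ i ≤ w i := fun i hi => by
      rcases hi.lt_or_eq with h | rfl
      · exact (hwlt h).ge
      · rw [hwn]
        have : 0 < θ ^ i := by positivity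
        nlinarith
    have hτ : ∀ i ≤ n, ∀ v ∈ V i,
        tauNorm P φ (chainIncrement X π i v) ≤ ε₀ / (1 - θ) * w i := by
      intro i hi v _
      have h1 : ε₀ * θ ^ i ≤ ε₀ / (1 - θ) * w i := by
        refine le_trans (le_of_eq ?_) (mul_le_mul_of_nonneg_left (hwge i hi)
          (by positivity : 0 ≤ ε₀ / (1 - θ)))
        field_simp
      refine le_trans ?_ h1
      cases i with
      | zero => exact (hε₀ v).trans_eq (by simp)
      | succ i => exact (hπle i v).trans_eq (by ring)
    have h := measure_exists_ge_le_of_chain hφ hX (π := π) (V := V) (n := n)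
      (fun i hi v _ => by rw [hVlt hi]; exact hπmem i v) hwpos
      (by rw [Finset.sum_range_succ, hwn, hwsum]) hτ hl e
    rw [hVn, Finset.prod_range_succ, hVn, hwn] at h
    refine h.trans (mul_le_mul_right (mul_le_mul_left ?_ _) A)
    have hprod : ∏ i ∈ Finset.range n, ((V i).card : ℝ≥0∞) ^ w i =
        ENNReal.ofReal (∏ i ∈ Finset.range n, ((W i).card : ℝ) ^ w i) := by
      rw [ENNReal.ofReal_prod_of_nonneg fun i _ => by positivity]
      refine Finset.prod_congr rfl fun i hi => ?_
      rw [hVlt (Finset.mem_range.1 hi), ← ENNReal.ofReal_rpow_of_nonneg (by positivity)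
        (hwpos i).le, ENNReal.ofReal_natCast]
    rw [hprod]
    have hW1 : ∀ i, (1 : ℝ) ≤ (W i).card := fun i => by exact_mod_cast hWne i
    refine prod_rpow_le_incInv hrconv (fun i => (hwpos i).le) (by positivity) hwsum hW1 ?_
    refine le_trans (add_le_add_left (Finset.sum_le_sum fun i hi => ?_) _)
      (geom_sum_le_entropyIntegral hσcont hσ0 hrmono hI ⟨hθ0, hθ1⟩ n hδ)
    rw [hwlt (Finset.mem_range.1 hi)]
    exact mul_le_mul_of_nonneg_left
      (hrmono (hW1 i) (one_le_coverBound T σ _) (hWcard i)) (by positivity)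
  rcases eq_or_ne R ⊤ with hRt | hRt
  · rw [hRt, ENNReal.mul_top hA0]
    exact le_top
  have hFt : Tendsto (fun n : ℕ => (F.card : ℝ≥0∞) ^ (θ ^ n)) atTop (𝓝 1) := by
    have hpos : (0 : ℝ) < F.card := by exact_mod_cast hF.card_pos
    have hreal : Tendsto (fun n : ℕ => (F.card : ℝ) ^ (θ ^ n)) atTop (𝓝 1) := by
      have := (Real.continuousAt_const_rpow hpos.ne').tendsto.comp
        (tendsto_pow_atTop_nhds_zero_of_lt_one hθ0.le hθ1)
      simpa [Function.comp_def] using this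
    have := ENNReal.tendsto_ofReal hreal
    simpa [← ENNReal.ofReal_rpow_of_pos hpos] using this
  have hlim := ENNReal.Tendsto.const_mul (a := A)
    (ENNReal.Tendsto.const_mul (a := R) hFt (Or.inr hRt))
    (Or.inr (by rw [hA]; exact ENNReal.mul_ne_top ENNReal.ofNat_ne_top ENNReal.ofReal_ne_top))
  rw [mul_one] at hlim
  exact ge_of_tendsto' hlim key

theorem measure_biUnion_le_of_finset {Ω ι : Type*} [MeasurableSpace Ω] {P : Measure Ω}
    {s : ι → Set Ω} {S : Set ι} (hS : S.Countable) {B : ℝ≥0∞}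
    (h : ∀ F : Finset ι, P (⋃ v ∈ F, s v) ≤ B) : P (⋃ v ∈ S, s v) ≤ B := by
  have := hS.to_subtype
  have hU : ⋃ v ∈ S, s v = ⋃ F : Finset S, ⋃ v ∈ F.map (Function.Embedding.subtype _), s v := by
    ext ω
    simp only [mem_iUnion, exists_prop, Finset.mem_map, Function.Embedding.subtype_apply]
    constructor
    · rintro ⟨v, hv, hω⟩
      exact ⟨{⟨v, hv⟩}, v, ⟨⟨v, hv⟩, Finset.mem_singleton_self _, rfl⟩, hω⟩
    · rintro ⟨F, v, ⟨u, -, rfl⟩, hω⟩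
      exact ⟨u, u.2, hω⟩
  have hmono : Monotone fun F : Finset S =>
      ⋃ v ∈ F.map (Function.Embedding.subtype _), s v := fun F G hFG =>
    biUnion_subset_biUnion_left fun v hv => Finset.map_subset_map.2 hFG hv
  rw [hU, hmono.directed_le.measure_iUnion]
  exact iSup_le fun F => h _

/-- A separable process exceeds no level that it does not approach on a countable set. -/
theorem IsSeparableProcess.measure_iSup_ge_le {Ω ι : Type*} [MeasurableSpace Ω] {P : Measure Ω}
    {ρ : ι → ι → ℝ} {X : ι → Ω → ℝ} (hsep : IsSeparableProcess P ρ X) {e ε : ℝ} (he : e < ε)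
    (hε : 0 < ε) {B : ℝ≥0∞} (h : ∀ F : Finset ι, P {ω | ∃ v ∈ F, e ≤ |X v ω|} ≤ B) :
    P {ω | ENNReal.ofReal ε ≤ ⨆ t, ENNReal.ofReal |X t ω|} ≤ B := by
  obtain ⟨S, hS, -, hae⟩ := hsep
  refine (measure_mono_ae ?_).trans (measure_biUnion_le_of_finset (s := fun v => {ω | e ≤ |X v ω|})
    hS fun F => ?_)
  · filter_upwards [hae] with ω hω hsup
    by_contra hnot
    have hlt : ∀ v ∈ S, |X v ω| < e := fun v hv => by
      by_contra hge
      exact hnot (mem_biUnion hv (not_lt.1 hge))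
    have hall := hω univ (Icc (-e) e) (fun _ _ => ⟨1, one_pos, fun _ _ => mem_univ _⟩) isClosed_Icc
      fun t ht => abs_le.1 (hlt t ht.2).le
    have hle : ENNReal.ofReal ε ≤ ENNReal.ofReal e := le_trans hsup
      (iSup_le fun t => ENNReal.ofReal_le_ofReal (abs_le.2 (hall t (mem_univ t))))
    exact hle.not_gt ((ENNReal.ofReal_lt_ofReal_iff hε).2 he)
  · refine (measure_mono fun ω hω => ?_).trans (h F)
    simpa using hω

/-- Optimisation of Chernoff bounds through the Young-Fenchel transform. -/
theorem le_exp_neg_youngFenchel {φ : ℝ → ℝ} {x : ℝ} {m R : ℝ≥0∞} (hm : m ≠ ⊤)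
    (h : ∀ y, m ≤ 2 * ENNReal.ofReal (Real.exp (-(x * y - φ y))) * R) :
    m ≤ 2 * (ENNReal.ofReal (Real.exp (-youngFenchel φ x)) * R) := by
  rcases eq_or_ne R ⊤ with rfl | hR
  · rw [ENNReal.mul_top (ENNReal.ofReal_pos.2 (Real.exp_pos _)).ne']
    simp
  rcases eq_or_ne m 0 with rfl | hm0
  · exact zero_le
  lift m to NNReal using hm
  lift R to NNReal using hR
  have hm1 : (0 : ℝ) < m := by
    have : m ≠ 0 := by exact_mod_cast hm0
    positivity
  have hconv : ∀ z : ℝ, (m : ℝ≥0∞) ≤ 2 * (ENNReal.ofReal (Real.exp (-z)) * R) ↔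
      (m : ℝ) ≤ 2 * (Real.exp (-z) * R) := fun z => by
    rw [← ENNReal.ofReal_coe_nnreal (p := m), ← ENNReal.ofReal_coe_nnreal (p := R),
      ← ENNReal.ofReal_mul (Real.exp_nonneg _), ← ENNReal.ofReal_ofNat 2,
      ← ENNReal.ofReal_mul zero_le_two, ENNReal.ofReal_le_ofReal_iff (by positivity)]
  have hiff : ∀ z : ℝ, (m : ℝ) ≤ 2 * (Real.exp (-z) * R) ↔ Real.exp z ≤ 2 * R / m := fun z => by
    rw [le_div_iff₀ hm1, Real.exp_neg, ← div_eq_inv_mul, ← mul_div_assoc,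
      le_div_iff₀ (Real.exp_pos z), mul_comm]
  have hy : ∀ y, Real.exp (x * y - φ y) ≤ 2 * R / m := fun y =>
    (hiff _).1 ((hconv _).1 (by simpa only [mul_assoc] using h y))
  have hpos : (0 : ℝ) < 2 * R / m := (Real.exp_pos _).trans_le (hy 0)
  refine (hconv _).2 ((hiff _).2 ?_)
  rw [← Real.le_log_iff_exp_le hpos]
  exact ciSup_le fun y => (Real.le_log_iff_exp_le hpos).2 (hy y)

theorem theorem6 {Ω : Type*} [MeasurableSpace Ω] (P : Measure Ω) [IsProbabilityMeasure P]
    (φ : ℝ → ℝ) (hφ : IsOrliczNFunction φ) (hQ : ConditionQ φ)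
    (T : ℝ) (hT : 0 ≤ T) (X : Icc (0 : ℝ) T → Ω → ℝ)
    (hX : ∀ t, IsPhiSubGaussian P φ (X t))
    (hsep : IsSeparableProcess P (processDist P φ X) X)
    (ε₀ : ℝ) (hε₀ : IsLUB (range fun t => tauNorm P φ (X t)) ε₀) (hε₀pos : 0 < ε₀)
    (σ : ℝ → ℝ) (hσmono : MonotoneOn σ (Ici 0)) (hσcont : ContinuousOn σ (Ici 0))
    (hσ0 : σ 0 = 0)
    (hXσ : ∀ h : ℝ, 0 ≤ h → ∀ t s : Icc (0 : ℝ) T, |(t : ℝ) - s| ≤ h →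
      processDist P φ X t s ≤ σ h)
    (r : ℝ → ℝ) (hr0 : ∀ x, 1 ≤ x → 0 ≤ r x) (hrmono : MonotoneOn r (Ici 1))
    (hrconv : ConvexOn ℝ (Ici 0) (fun x => r (Real.exp x)))
    (hI : ∀ v : ℝ, 0 < v →
      IntervalIntegrable (fun u => r (coverBound T σ u)) volume 0 v) :
    ∀ θ ∈ Ioo (0 : ℝ) 1, ∀ ε : ℝ, 0 < ε →
      P {ω | ENNReal.ofReal ε ≤ ⨆ t, ENNReal.ofReal |X t ω|} ≤
        2 * (ENNReal.ofReal (Real.exp (-youngFenchel φ (ε * (1 - θ) / ε₀))) *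
          incInv 1 r (entropyIntegral T σ r (θ * ε₀) / (θ * ε₀))) := by
  rintro θ ⟨hθ0, hθ1⟩ ε hε
  have h1θ : 0 < 1 - θ := by linarith
  refine le_exp_neg_youngFenchel (measure_ne_top P _) fun y => ?_
  set R : ℝ≥0∞ := incInv 1 r (entropyIntegral T σ r (θ * ε₀) / (θ * ε₀)) with hR
  rcases eq_or_ne R ⊤ with hRt | hRt
  · rw [hRt, ENNReal.mul_top (mul_ne_zero two_ne_zero (ENNReal.ofReal_pos.2 (Real.exp_pos _)).ne')]
    exact le_top
  set l : ℝ := |y| * (1 - θ) / ε₀ with hl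
  have hl0 : 0 ≤ l := by positivity
  have hcl : φ (ε₀ / (1 - θ) * l) = φ y := by
    rw [← hφ.map_abs y, hl]
    congr 1
    field_simp
  have hlt : ∀ᶠ e in 𝓝[<] ε, P {ω | ENNReal.ofReal ε ≤ ⨆ t, ENNReal.ofReal |X t ω|} ≤
      2 * ENNReal.ofReal (Real.exp (-(l * e - φ y))) * R := by
    filter_upwards [self_mem_nhdsWithin] with e he
    refine hsep.measure_iSup_ge_le he hε fun F => ?_
    have h := measure_finset_ge_le hφ hT hX (fun t => hε₀.1 (mem_range_self t)) hε₀pos hσcont hσ0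
      hXσ hrmono hrconv hI ⟨hθ0, hθ1⟩ F hl0 e
    rwa [hcl] at h
  have hcont : Continuous fun e : ℝ => 2 * ENNReal.ofReal (Real.exp (-(l * e - φ y))) * R := by
    refine (ENNReal.continuous_mul_const hRt).comp
      ((ENNReal.continuous_const_mul ENNReal.ofNat_ne_top).comp
        (ENNReal.continuous_ofReal.comp (by fun_prop)))
  refine (ge_of_tendsto (hcont.continuousWithinAt (s := Iio ε) (x := ε)).tendsto hlt).trans ?_
  have hxy : ε * (1 - θ) / ε₀ * y ≤ l * ε := by
    rw [hl, show |y| * (1 - θ) / ε₀ * ε = ε * (1 - θ) / ε₀ * |y| by ring]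
    exact mul_le_mul_of_nonneg_left (le_abs_self y) (by positivity)
  gcongr
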